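/- **Theorem 2.** Fix constants $C_1,C_2,C_3,C_4,C_\varepsilon>0$. There is a constant $C>0$, depending only on these five constants, such that the following holds for all positive integers $n,p,q,r$ and all $\delta\in(0,1)$. Let $x\in\mathbb R^p$ be a random vector with an everywhere differentiable Lebesgue density $P$, and let $s(x)=-\nabla P(x)/P(x)=(s_1(x),\dots,s_p(x))^\top$ be its (known) first-order score. Let $B\in\mathbb R^{p\times r}$ have orthonormal columns, let $f_1,\dots,f_q:\mathbb R^r\to\mathbb R$ be differentiable, put $\mathcal F=(f_1,\dots,f_q)^\top$, and let $$y=\mathcal F(B^\top x)+\varepsilon ,$$ where the noise vector $\varepsilon\in\mathbb R^q$ is independent of $x$ and has i.i.d. components $\varepsilon_1,\dots,\varepsilon_q$ with mean zero that are sub-Gaussian: $\sup_{\ell\in\mathbb N_+}\ell^{-1/2}\{\mathbb E|\varepsilon_j|^\ell\}^{1/\ell}\le C_\varepsilon$ (for instance $\varepsilon_j\sim\mathcal N(0,\sigma_\varepsilon^2)$ with $\sigma_\varepsilon\le C_\varepsilon$). Assume that the expectations defining $$M_1=\mathbb E\bigl[\nabla f_1(B^\top x),\dots,\nabla f_q(B^\top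 x)\bigr]\in\mathbb R^{r\times q}$$ exist, and that, for all $k\in[p]$, $j\in[q]$, $l\in[r]$, with $\sigma_r$ denoting the $r$-th largest singular value, 1. $\sup_{\ell\in\mathbb N_+}\ell^{-1/2}\{\mathbb E|s_k(x)|^\ell\}^{1/\ell}\le C_1$; 2. $\sup_{\ell\in\mathbb N_+}\{\mathbb E f_j(B^\top x)^{2\ell}\}^{1/(2\ell)}\le C_2$; 3. $|\mathbb E\,\partial_l f_j(B^\top x)|\ge C_3/\sqrt r$; 4. $\sigma_r(M_1)\ge C_4\sqrt{q/r}$. Let $(x_i,y_i)$, $i=1,\dots,n$, be i.i.d. copies of $(x,y)$, and let the columns of $\widehat B\in\mathbb R^{p\times r}$ be top-$r$ left singular vectors of $\frac1n\sum_{i=1}^n s(x_i)y_i^\top$, that is, the first $r$ columns of $U$ in a singular value decomposition $U\Sigma V^\top$ of that matrix with singular values in decreasing order. Then, with probability at least $1-\delta$ (and whichever singular value decomposition is used), $$\inf_{V\in\mathbb R^{r\times r},\,V^\top V=I_r}\ \|B-\widehat B V\|_F\ \le\ C\,\sqrt{\frac{rp}{n}}\,\sqrt{\ln\frac{pq}{\delta}}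 .$$ -/

import Mathlib

open MeasureTheory ProbabilityTheory
open scoped ENNReal Matrix

noncomputable section

/-! Vectors in `ℝᵈ` are functions `Fin d → ℝ`. Only Lebesgue measure, differentiability and partial
derivatives are used on them, none of which depends on the choice of norm. -/

/-- `P : ℝᵖ → ℝ` is an (everywhere) differentiable probability density. -/
structure IsDiffDensity {p : ℕ} (P : (Fin p → ℝ) → ℝ) : Prop where
  nonneg : ∀ x, 0 ≤ P x
  differentiable : Differentiable ℝ P
  lintegral_eq_one : ∫⁻ x, ENNReal.ofReal (P x) = 1

/-- The distribution on `ℝᵖ` with Lebesgue density `P`. -/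
def densityLaw {p : ℕ} (P : (Fin p → ℝ) → ℝ) : Measure (Fin p → ℝ) :=
  (volume : Measure (Fin p → ℝ)).withDensity fun x => ENNReal.ofReal (P x)

/-- Partial derivative of `g` at `z` with respect to the coordinate `l`. -/
def partialDeriv {d : ℕ} (g : (Fin d → ℝ) → ℝ) (l : Fin d) (z : Fin d → ℝ) : ℝ :=
  fderiv ℝ g z (Pi.single l 1)

/-- The first-order score `s(x) = - ∇P(x) / P(x)` of the density `P`
(the value on the null set `P = 0` is irrelevant). -/
def scoreFn {p : ℕ} (P : (Fin p → ℝ) → ℝ) (x : Fin p → ℝ) : Fin p → ℝ :=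
  fun k => -(partialDeriv P k x) / P x

/-- Sub-Gaussian moment growth with constant `K`:
`ℓ^(-1/2) (E|Z|^ℓ)^(1/ℓ) ≤ K` for every positive integer `ℓ`. -/
def SubGaussianMoments {Ω : Type*} [MeasurableSpace Ω] (μ : Measure Ω) (Z : Ω → ℝ) (K : ℝ) : Prop :=
  ∀ ℓ : ℕ, 1 ≤ ℓ → eLpNorm Z (ℓ : ℝ≥0∞) μ ≤ ENNReal.ofReal (K * √(ℓ : ℝ))

/-- The `r × q` matrix `M₁ = E[∇f₁(Bᵀx), …, ∇f_q(Bᵀx)]`, for `x` with density `P`. -/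
def meanGradMatrix {p q r : ℕ} (P : (Fin p → ℝ) → ℝ) (B : Matrix (Fin p) (Fin r) ℝ)
    (f : Fin q → (Fin r → ℝ) → ℝ) : Matrix (Fin r) (Fin q) ℝ :=
  Matrix.of fun l j => ∫ x, partialDeriv (f j) l (Bᵀ *ᵥ x) ∂(densityLaw P)

/-- The `i`-th largest singular value `σ_i(A)`, `i ≥ 1`, of a real matrix
(Mathlib's singular values are indexed from `0`). -/
def matrixSingularValue {m n : ℕ} (A : Matrix (Fin m) (Fin n) ℝ) (i : ℕ) : ℝ :=
  (Matrix.toEuclideanLin A).singularValues (i - 1)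

/-- `A = U Σ Vᵀ` is a singular value decomposition, with singular values
`σ 0 ≥ σ 1 ≥ … ≥ 0` on the diagonal of the rectangular matrix `Σ`. -/
def IsSVD {m n : ℕ} (A : Matrix (Fin m) (Fin n) ℝ) (U : Matrix (Fin m) (Fin m) ℝ) (σ : ℕ → ℝ)
    (V : Matrix (Fin n) (Fin n) ℝ) : Prop :=
  U ∈ Matrix.orthogonalGroup (Fin m) ℝ ∧ V ∈ Matrix.orthogonalGroup (Fin n) ℝ ∧
    Antitone σ ∧ (∀ i, 0 ≤ σ i) ∧
    A = U * Matrix.of (fun (i : Fin m) (j : Fin n) => if (i : ℕ) = j then σ i else 0) * Vᵀ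

/-- `W = SVD_{l,r}(A)`: the columns of `W` are the first `r` columns of `U` for some singular value
decomposition `A = U Σ Vᵀ`, i.e. a choice of top-`r` left singular vectors of `A`. -/
def IsTopLeftSingular {m n r : ℕ} (A : Matrix (Fin m) (Fin n) ℝ) (W : Matrix (Fin m) (Fin r) ℝ) :
    Prop :=
  ∃ (U : Matrix (Fin m) (Fin m) ℝ) (σ : ℕ → ℝ) (V : Matrix (Fin n) (Fin n) ℝ) (hr : r ≤ m),
    IsSVD A U σ V ∧ ∀ i k, W i k = U i (Fin.castLE hr k)

/-- Frobenius norm. -/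
def frobNorm {m n : ℕ} (A : Matrix (Fin m) (Fin n) ℝ) : ℝ :=
  √(∑ i, ∑ j, A i j ^ 2)

/-- `dist(Θ₁, Θ₂) = inf_V ‖Θ₁ - Θ₂ V‖_F` over orthogonal `r × r` matrices `V`. -/
def subspaceDist {p r : ℕ} (Θ₁ Θ₂ : Matrix (Fin p) (Fin r) ℝ) : ℝ :=
  ⨅ V : Matrix.orthogonalGroup (Fin r) ℝ, frobNorm (Θ₁ - Θ₂ * (V : Matrix (Fin r) (Fin r) ℝ))

/-- `(X i, Y i)`, `i = 1, …, n`, is an i.i.d. sample from the multiple response model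
`y = F(Bᵀ x) + ε`, `F = (f₁, …, f_q)`, where `x` has density `P` and is independent of the noise
`ε`, whose components are i.i.d. with mean zero. -/
structure IsIndexModelSample {Ω : Type*} [MeasurableSpace Ω] (μ : Measure Ω) {n p q r : ℕ}
    (P : (Fin p → ℝ) → ℝ) (B : Matrix (Fin p) (Fin r) ℝ) (f : Fin q → (Fin r → ℝ) → ℝ)
    (X : Fin n → Ω → Fin p → ℝ) (ε : Fin n → Ω → Fin q → ℝ) (Y : Fin n → Ω → Fin q → ℝ) :
    Prop where
  measurable_X : ∀ i, Measurable (X i)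
  measurable_noise : ∀ i, Measurable (ε i)
  /-- The model equation. -/
  model : ∀ i ω j, Y i ω j = f j (Bᵀ *ᵥ X i ω) + ε i ω j
  /-- Every feature vector has density `P`. -/
  law_X : ∀ i, μ.map (X i) = densityLaw P
  /-- The `n` observations are independent. -/
  indep_sample : iIndepFun (fun i ω => (X i ω, ε i ω)) μ
  /-- Noise is independent of the features. -/
  indep_noise : ∀ i, IndepFun (X i) (ε i) μ
  /-- The noise components are i.i.d. with mean zero. -/
  indep_noise_components : ∀ i, iIndepFun (fun j ω => ε i ω j) μ
  identDistrib_noise : ∀ i j i' j', IdentDistrib (fun ω => ε i ω j) (fun ω => ε i' ω j') μ μ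
  integrable_noise : ∀ i j, Integrable (fun ω => ε i ω j) μ
  mean_noise : ∀ i j, ∫ ω, ε i ω j ∂μ = 0

/-- The matrix `(1/n) ∑ᵢ s(xᵢ) yᵢᵀ`. -/
def scoreCrossMoment {n p q : ℕ} (P : (Fin p → ℝ) → ℝ) (x : Fin n → Fin p → ℝ)
    (y : Fin n → Fin q → ℝ) : Matrix (Fin p) (Fin q) ℝ :=
  (1 / (n : ℝ)) • ∑ i, Matrix.vecMulVec (scoreFn P (x i)) (y i)

end

/-!
The estimator is a spectral one, and the theorem combines an identity for the mean of the matrix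
`A = (1/n) ∑ s(xᵢ) yᵢᵀ` with a concentration and a perturbation bound.

*Mean.* Integration by parts against the density (Stein's identity,
`IsDiffDensity.integral_scoreFn_mul`) gives `E[s(x) f_j(Bᵀ x)] = E[∇(f_j ∘ Bᵀ)(x)]`, and the noise
is centered and independent of `x`; so `E A = B M₁`, whose column space is that of `B`
(`IsIndexModelSample.integral_score_mul`).

*Concentration.* The entries `s_k(x) y_j` are products of sub-Gaussian variables, hence
sub-exponential with constant `2 C₁ (C₂ + Cε)`. Bernstein's inequality, derived from the power
series of the moment generating function (`measureReal_lt_abs_average_sub_le`), and a union bound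
over the `p q` entries give `‖A - B M₁‖² ≲ p q L / n` with `L = log (2pq/δ)`, in Frobenius norm and
with probability at least `1 - δ`, as long as `2 L ≤ n` (`exists_event_scoreCrossMoment_close`).

*Perturbation.* By Ky Fan's maximum principle the projection `W Wᵀ` on the top left singular
vectors leaves a residual of `A` no larger than the projection `B Bᵀ` does, which is at most
`‖A - B M₁‖`. Hence `‖(1 - W Wᵀ) B M₁‖ ≤ 2 ‖A - B M₁‖`, and division by `σ_r(M₁)` bounds
`‖(1 - W Wᵀ) B‖`. The polar factor of `Wᵀ B` turns this into a bound on the distance, up to a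
factor `√2` (`IsTopLeftSingular.sq_mul_subspaceDist_sq_le`).

Since `σ_r(M₁)² ≥ C₄² q / r`, the factors `q` cancel and `r p L / n` is left. For `p ≥ 2`,
`L ≤ 2 log (pq/δ)`; for `p = 1` the distance vanishes. If `2 L > n`, the claimed bound exceeds the
trivial bound `√(2r)` on the distance.
-/

/-! ### Squared Frobenius norms -/

/-- The square of the Frobenius norm. -/
def frobSq {m n : ℕ} (A : Matrix (Fin m) (Fin n) ℝ) : ℝ :=
  ∑ i, ∑ j, A i j ^ 2

theorem frobSq_nonneg {m n : ℕ} (A : Matrix (Fin m) (Fin n) ℝ) : 0 ≤ frobSq A :=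
  Finset.sum_nonneg fun _ _ => Finset.sum_nonneg fun _ _ => sq_nonneg _

theorem frobSq_eq_trace_mul_transpose {m n : ℕ} (A : Matrix (Fin m) (Fin n) ℝ) :
    frobSq A = (A * Aᵀ).trace := by
  simp [frobSq, Matrix.trace, Matrix.mul_apply, sq]

theorem frobSq_eq_trace_transpose_mul {m n : ℕ} (A : Matrix (Fin m) (Fin n) ℝ) :
    frobSq A = (Aᵀ * A).trace := by
  rw [frobSq_eq_trace_mul_transpose, Matrix.trace_mul_comm]

theorem frobSq_sub_le {m n : ℕ} (A B : Matrix (Fin m) (Fin n) ℝ) :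
    frobSq (A - B) ≤ 2 * frobSq A + 2 * frobSq B := by
  simp only [frobSq, Finset.mul_sum, ← Finset.sum_add_distrib, Matrix.sub_apply]
  gcongr with i _ j _
  nlinarith [sq_nonneg (A i j + B i j)]

theorem frobSq_mul_of_mul_transpose_eq_one {m n k : ℕ} (A : Matrix (Fin m) (Fin n) ℝ)
    {V : Matrix (Fin n) (Fin k) ℝ} (hV : V * Vᵀ = 1) : frobSq (A * V) = frobSq A := by
  rw [frobSq_eq_trace_mul_transpose, frobSq_eq_trace_mul_transpose, Matrix.transpose_mul,
    Matrix.mul_assoc, ← Matrix.mul_assoc V, hV, Matrix.one_mul]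

theorem frobSq_of_transpose_mul_eq_one {m n : ℕ} {W : Matrix (Fin m) (Fin n) ℝ}
    (hW : Wᵀ * W = 1) : frobSq W = n := by
  rw [frobSq_eq_trace_transpose_mul, hW]
  simp

/-- Pythagoras for the orthogonal projection `W * Wᵀ` onto the column space of `W`. -/
theorem frobSq_sub_proj {m n r : ℕ} {W : Matrix (Fin m) (Fin r) ℝ} (hW : Wᵀ * W = 1)
    (A : Matrix (Fin m) (Fin n) ℝ) :
    frobSq (A - W * (Wᵀ * A)) = frobSq A - frobSq (Wᵀ * A) := by
  simp only [frobSq_eq_trace_transpose_mul]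
  have : (A - W * (Wᵀ * A))ᵀ * (A - W * (Wᵀ * A)) = Aᵀ * A - (Wᵀ * A)ᵀ * (Wᵀ * A) := by
    have h : Aᵀ * W * (Wᵀ * W) * (Wᵀ * A) = Aᵀ * W * (Wᵀ * A) := by rw [hW, Matrix.mul_one]
    simp only [Matrix.transpose_sub, Matrix.transpose_mul, Matrix.transpose_transpose,
      Matrix.sub_mul, Matrix.mul_sub]
    simp only [Matrix.mul_assoc] at h ⊢
    rw [h]
    abel
  rw [this, Matrix.trace_sub]

theorem frobSq_transpose_mul_le {m n r : ℕ} {W : Matrix (Fin m) (Fin r) ℝ} (hW : Wᵀ * W = 1)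
    (A : Matrix (Fin m) (Fin n) ℝ) : frobSq (Wᵀ * A) ≤ frobSq A := by
  linarith [frobSq_sub_proj hW A, frobSq_nonneg (A - W * (Wᵀ * A))]

/-! ### Ky Fan's maximum principle -/

/-- A weighted sum of a decreasing sequence, with weights in `[0, 1]` of total mass `r`, is largest
when the weights sit on the first `r` terms. -/
theorem sum_mul_le_sum_ite_lt {m r : ℕ} (hr : r ≤ m) {τ w : Fin m → ℝ} (hτ : Antitone τ)
    (hw0 : ∀ i, 0 ≤ w i) (hw1 : ∀ i, w i ≤ 1) (hw : ∑ i, w i = r) :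
    ∑ i, τ i * w i ≤ ∑ i, τ i * (if (i : ℕ) < r then 1 else 0) := by
  rcases Nat.eq_zero_or_pos r with rfl | hr0
  · have h0 : ∀ i, w i = 0 := by
      simpa [Finset.sum_eq_zero_iff_of_nonneg fun i _ => hw0 i] using hw
    simp [h0]
  have hcard : ∑ i : Fin m, (if (i : ℕ) < r then (1 : ℝ) else 0) = r := by
    rw [Finset.sum_ite]
    simp [Fin.card_filter_val_lt, hr]
  set c := τ ⟨r - 1, by omega⟩ with hc
  have key : ∑ i, (τ i - c) * (w i - if (i : ℕ) < r then 1 else 0) ≤ 0 := by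
    refine Finset.sum_nonpos fun i _ => ?_
    split_ifs with h
    · have : c ≤ τ i := hτ (Fin.le_def.2 (by simp; omega))
      exact mul_nonpos_of_nonneg_of_nonpos (by linarith) (by linarith [hw1 i])
    · have : τ i ≤ c := hτ (Fin.le_def.2 (by simp; omega))
      exact mul_nonpos_of_nonpos_of_nonneg (by linarith) (by linarith [hw0 i])
  have expand : ∑ i, (τ i - c) * (w i - if (i : ℕ) < r then 1 else 0)
      = ∑ i, τ i * w i - ∑ i, τ i * (if (i : ℕ) < r then 1 else 0)
        - c * (∑ i, w i - ∑ i : Fin m, (if (i : ℕ) < r then (1 : ℝ) else 0)) := by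
    rw [← Finset.sum_sub_distrib, ← Finset.sum_sub_distrib, Finset.mul_sum,
      ← Finset.sum_sub_distrib]
    exact Finset.sum_congr rfl fun i _ => by ring
  rw [expand, hw, hcard] at key
  linarith

theorem rectDiagonal_mul_transpose {m n : ℕ} (σ : ℕ → ℝ) :
    Matrix.of (fun (i : Fin m) (j : Fin n) => if (i : ℕ) = j then σ i else 0) *
      (Matrix.of (fun (i : Fin m) (j : Fin n) => if (i : ℕ) = j then σ i else 0))ᵀ =
    Matrix.diagonal fun i : Fin m => if (i : ℕ) < n then σ i ^ 2 else 0 := by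
  ext i k
  simp only [Matrix.mul_apply, Matrix.of_apply, Matrix.transpose_apply, Matrix.diagonal_apply]
  by_cases hi : (i : ℕ) < n
  · rw [Finset.sum_eq_single (⟨i, hi⟩ : Fin n)]
    · by_cases h : i = k
      · subst h; simp [hi, sq]
      · have : ¬ ((k : ℕ) = i) := fun h' => h (Fin.ext h'.symm)
        simp [h, this]
    · intro j _ hj
      have : ¬ ((i : ℕ) = j) := fun h' => hj (Fin.ext h'.symm)
      simp [this]
    · simp
  · rw [Finset.sum_eq_zero]
    · simp [hi]
    · intro j _
      have : ¬ ((i : ℕ) = j) := by have := j.2; omega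
      simp [this]

/-- In terms of a singular value decomposition `A = U Σ Vᵀ`, the squared norm `‖Bᵀ A‖²` is a
weighted sum of the squared singular values. -/
theorem IsSVD.frobSq_transpose_mul {m n r : ℕ} {A : Matrix (Fin m) (Fin n) ℝ}
    {U : Matrix (Fin m) (Fin m) ℝ} {σ : ℕ → ℝ} {V : Matrix (Fin n) (Fin n) ℝ}
    (h : IsSVD A U σ V) (B : Matrix (Fin m) (Fin r) ℝ) :
    frobSq (Bᵀ * A) =
      ∑ i : Fin m, (if (i : ℕ) < n then σ i ^ 2 else 0) * ((Bᵀ * U)ᵀ * (Bᵀ * U)) i i := by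
  obtain ⟨hU, hV, hσ, hσ0, hA⟩ := h
  have hVV : Vᵀ * Vᵀᵀ = 1 := by
    rw [Matrix.transpose_transpose]
    exact (Matrix.mem_orthogonalGroup_iff' (Fin n) ℝ).1 hV
  rw [hA, ← Matrix.mul_assoc, frobSq_mul_of_mul_transpose_eq_one _ hVV, ← Matrix.mul_assoc,
    frobSq_eq_trace_mul_transpose, Matrix.transpose_mul, Matrix.mul_assoc,
    ← Matrix.mul_assoc (Matrix.of _), rectDiagonal_mul_transpose, Matrix.trace_mul_comm,
    Matrix.mul_assoc]
  simp [Matrix.trace, Matrix.diagonal_mul]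

theorem IsTopLeftSingular.transpose_mul_self {m n r : ℕ} {A : Matrix (Fin m) (Fin n) ℝ}
    {W : Matrix (Fin m) (Fin r) ℝ} (h : IsTopLeftSingular A W) : Wᵀ * W = 1 := by
  obtain ⟨U, σ, V, hr, ⟨hU, -⟩, hW⟩ := h
  have hUU : Uᵀ * U = 1 := (Matrix.mem_orthogonalGroup_iff' (Fin m) ℝ).1 hU
  ext a b
  have := congrFun (congrFun hUU (Fin.castLE hr a)) (Fin.castLE hr b)
  simpa [Matrix.mul_apply, hW, Matrix.one_apply] using this

/-- **Ky Fan's maximum principle**: among matrices `B` with `r` orthonormal columns, the norm of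
`Bᵀ A` is largest for top-`r` left singular vectors of `A`. -/
theorem IsTopLeftSingular.frobSq_le {m n r : ℕ} {A : Matrix (Fin m) (Fin n) ℝ}
    {W : Matrix (Fin m) (Fin r) ℝ} (h : IsTopLeftSingular A W) {B : Matrix (Fin m) (Fin r) ℝ}
    (hB : Bᵀ * B = 1) : frobSq (Bᵀ * A) ≤ frobSq (Wᵀ * A) := by
  obtain ⟨U, σ, V, hr, hsvd, hW⟩ := h
  rw [hsvd.frobSq_transpose_mul, hsvd.frobSq_transpose_mul]
  obtain ⟨hU, hV, hσ, hσ0, -⟩ := hsvd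
  have hUU : Uᵀ * U = 1 := (Matrix.mem_orthogonalGroup_iff' (Fin m) ℝ).1 hU
  have hUU' : U * Uᵀ = 1 := (Matrix.mem_orthogonalGroup_iff (Fin m) ℝ).1 hU
  have hWU : ∀ i : Fin m, ((Wᵀ * U)ᵀ * (Wᵀ * U)) i i = if (i : ℕ) < r then 1 else 0 := by
    have hQ : ∀ a i, (Wᵀ * U) a i = if Fin.castLE hr a = i then 1 else 0 := by
      intro a i
      have := congrFun (congrFun hUU (Fin.castLE hr a)) i
      simpa [Matrix.mul_apply, hW, Matrix.one_apply] using this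
    intro i
    simp only [Matrix.mul_apply, Matrix.transpose_apply] at hQ ⊢
    simp only [hQ]
    by_cases hi : (i : ℕ) < r
    · rw [Finset.sum_eq_single (⟨i, hi⟩ : Fin r)]
      · simp [hi]
      · intro b _ hb
        have : ¬ (Fin.castLE hr b = i) := fun h' => hb (Fin.ext (by simp [← h']))
        simp [this]
      · simp
    · rw [Finset.sum_eq_zero]
      · simp [hi]
      · intro b _
        have : ¬ (Fin.castLE hr b = i) := fun h' => hi (by simp [← h'])
        simp [this]
  obtain ⟨Q, hQdef⟩ : ∃ Q, Q = Bᵀ * U := ⟨_, rfl⟩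
  rw [← hQdef]
  have hQQ : Q * Qᵀ = 1 := by
    rw [hQdef, Matrix.transpose_mul, Matrix.transpose_transpose, Matrix.mul_assoc,
      ← Matrix.mul_assoc U, hUU', Matrix.one_mul, hB]
  have hdiag : ∀ i, (Qᵀ * Q) i i = ∑ a, Q a i ^ 2 := fun i => by
    simp [Matrix.mul_apply, sq]
  -- `Qᵀ Q` is a symmetric idempotent, so its diagonal entries are at least their own squares.
  have hidem : ∀ i, (Qᵀ * Q) i i = ∑ k, (Qᵀ * Q) i k ^ 2 := fun i => by
    have h1 : (Qᵀ * Q) * (Qᵀ * Q)ᵀ = Qᵀ * Q := by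
      rw [Matrix.transpose_mul, Matrix.transpose_transpose, Matrix.mul_assoc,
        ← Matrix.mul_assoc Q, hQQ, Matrix.one_mul]
    conv_lhs => rw [← h1]
    rw [Matrix.mul_apply]
    simp only [Matrix.transpose_apply, sq]
  simp only [hWU]
  refine sum_mul_le_sum_ite_lt hr ?_ ?_ ?_ ?_
  · intro i j hij
    have hij' : (i : ℕ) ≤ j := hij
    have hs : σ j ≤ σ i := hσ hij'
    dsimp only
    split_ifs with h1 h2 h2
    · exact pow_le_pow_left₀ (hσ0 _) hs 2
    · omega
    · positivity
    · exact le_rfl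
  · intro i
    rw [hdiag]
    positivity
  · intro i
    have h1 : (Qᵀ * Q) i i ^ 2 ≤ (Qᵀ * Q) i i := by
      conv_rhs => rw [hidem]
      exact Finset.single_le_sum (f := fun k => (Qᵀ * Q) i k ^ 2) (fun _ _ => sq_nonneg _)
        (Finset.mem_univ i)
    nlinarith
  · have : (Qᵀ * Q).trace = r := by
      rw [Matrix.trace_mul_comm, hQQ]
      simp
    simpa [Matrix.trace] using this

/-! ### The Procrustes problem and the distance of subspaces -/

/-- The matrix with columns `b i` is orthogonal when `b` is an orthonormal basis. -/
theorem OrthonormalBasis.transpose_mul_self {r : ℕ}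
    (b : OrthonormalBasis (Fin r) ℝ (EuclideanSpace ℝ (Fin r))) :
    (Matrix.of fun a i => b i a)ᵀ * (Matrix.of fun a i => b i a) =
      (1 : Matrix (Fin r) (Fin r) ℝ) := by
  ext i j
  have := orthonormal_iff_ite.1 b.orthonormal i j
  rw [EuclideanSpace.inner_eq_star_dotProduct] at this
  simp only [Matrix.mul_apply, Matrix.transpose_apply, Matrix.of_apply, Matrix.one_apply]
  rw [← this]
  simp [dotProduct, mul_comm]

/-- Orthogonal Procrustes problem for a contraction `G`: the orthogonal polar factor `V` of `G`
satisfies `⟨V, G⟩ = ∑ sᵢ ≥ ∑ sᵢ² = ‖G‖²`, where the `sᵢ ≤ 1` are the singular values of `G`. -/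
theorem exists_orthogonal_frobSq_le_trace {r : ℕ} (G : Matrix (Fin r) (Fin r) ℝ)
    (hG : ∀ v : Fin r → ℝ, (G *ᵥ v) ⬝ᵥ (G *ᵥ v) ≤ v ⬝ᵥ v) :
    ∃ V ∈ Matrix.orthogonalGroup (Fin r) ℝ, frobSq G ≤ (Vᵀ * G).trace := by
  have hS : (Gᵀ * G).IsHermitian := by
    rw [← Matrix.conjTranspose_eq_transpose_of_trivial]
    exact Matrix.isHermitian_conjTranspose_mul_self G
  set z := hS.eigenvectorBasis with hz
  set l := hS.eigenvalues with hl
  have hzdot : ∀ i j, (z i).ofLp ⬝ᵥ (z j).ofLp = if i = j then 1 else 0 := fun i j => by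
    have := orthonormal_iff_ite.1 z.orthonormal i j
    rw [EuclideanSpace.inner_eq_star_dotProduct] at this
    rw [← this, dotProduct_comm]
    simp
  have hGz : ∀ i j, (G *ᵥ (z i).ofLp) ⬝ᵥ (G *ᵥ (z j).ofLp) = if i = j then l i else 0 := fun i j => by
    rw [← Matrix.vecMul_transpose, ← Matrix.dotProduct_mulVec, Matrix.mulVec_mulVec,
      hS.mulVec_eigenvectorBasis, dotProduct_smul, hzdot]
    split_ifs with h
    · subst h; simp [hl]
    · simp
  have hl0 : ∀ i, 0 ≤ l i := fun i => by
    have := hGz i i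
    rw [if_pos rfl] at this
    rw [← this]
    exact Finset.sum_nonneg fun _ _ => mul_self_nonneg _
  have hl1 : ∀ i, l i ≤ 1 := fun i => by
    have := hG (z i).ofLp
    rwa [hGz, hzdot, if_pos rfl, if_pos rfl] at this
  -- The images `G zᵢ` are orthogonal: normalise the nonzero ones and complete to a basis.
  obtain ⟨w, hw⟩ := Orthonormal.exists_orthonormalBasis_extension_of_card_eq (𝕜 := ℝ)
    (E := EuclideanSpace ℝ (Fin r)) (ι := Fin r) (by simp)
    (v := fun i => WithLp.toLp 2 ((√(l i))⁻¹ • (G *ᵥ (z i).ofLp))) (s := {i | l i ≠ 0}) (by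
      rw [orthonormal_iff_ite]
      rintro ⟨i, hi⟩ ⟨j, hj⟩
      have hi' : 0 < l i := lt_of_le_of_ne (hl0 i) (Ne.symm hi)
      simp only [Set.domRestrict_apply, EuclideanSpace.inner_eq_star_dotProduct, star_trivial,
        smul_dotProduct, dotProduct_smul, hGz, Subtype.mk.injEq, smul_eq_mul]
      by_cases h : i = j
      · subst h
        have h2 := Real.mul_self_sqrt (hl0 i)
        have h3 : √(l i) ≠ 0 := (Real.sqrt_pos.2 hi').ne'
        simp only [if_true]
        field_simp
        nlinarith
      · simp [h, Ne.symm h])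
  have hwG : ∀ i, (w i).ofLp ⬝ᵥ (G *ᵥ (z i).ofLp) = √(l i) := fun i => by
    by_cases hi : l i = 0
    · have h0 : G *ᵥ (z i).ofLp = 0 := by
        have := hGz i i
        rw [if_pos rfl, hi] at this
        exact dotProduct_self_eq_zero.1 this
      simp [h0, hi]
    · rw [hw i hi]
      simp only [smul_dotProduct, hGz, if_true, smul_eq_mul]
      have h2 := Real.mul_self_sqrt (hl0 i)
      have h3 : √(l i) ≠ 0 := (Real.sqrt_pos.2 (lt_of_le_of_ne (hl0 i) (Ne.symm hi))).ne'
      field_simp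
      nlinarith
  set Z : Matrix (Fin r) (Fin r) ℝ := Matrix.of fun a i => z i a with hZ
  set W : Matrix (Fin r) (Fin r) ℝ := Matrix.of fun a i => w i a with hW
  have hZZ : Zᵀ * Z = 1 := z.transpose_mul_self
  have hWW : Wᵀ * W = 1 := w.transpose_mul_self
  refine ⟨W * Zᵀ, ?_, ?_⟩
  · rw [Matrix.mem_orthogonalGroup_iff']
    rw [Matrix.transpose_mul, Matrix.transpose_transpose,
      Matrix.mul_assoc, ← Matrix.mul_assoc Wᵀ, hWW, Matrix.one_mul]
    exact mul_eq_one_comm.1 hZZ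
  · rw [Matrix.transpose_mul, Matrix.transpose_transpose, Matrix.mul_assoc, Matrix.trace_mul_comm,
      Matrix.mul_assoc]
    have h1 : (Wᵀ * (G * Z)).trace = ∑ i, √(l i) := by
      simp only [Matrix.trace, Matrix.diag_apply, Matrix.mul_apply]
      refine Finset.sum_congr rfl fun i _ => ?_
      rw [← hwG]
      rfl
    have h2 : frobSq G = ∑ i, l i := by
      rw [frobSq_eq_trace_transpose_mul, hS.trace_eq_sum_eigenvalues]
      simp [hl]
    rw [h1, h2]
    refine Finset.sum_le_sum fun i _ => ?_
    exact Real.le_sqrt_of_sq_le (by nlinarith [hl0 i, hl1 i])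

/-- The distance of two subspaces is controlled by the part of the one outside the other. -/
theorem subspaceDist_sq_le {p r : ℕ} {B W : Matrix (Fin p) (Fin r) ℝ} (hB : Bᵀ * B = 1)
    (hW : Wᵀ * W = 1) : subspaceDist B W ^ 2 ≤ 2 * (r - frobSq (Wᵀ * B)) := by
  have hcontr : ∀ {M : Matrix (Fin p) (Fin r) ℝ}, Mᵀ * M = 1 → ∀ v : Fin r → ℝ,
      (M *ᵥ v) ⬝ᵥ (M *ᵥ v) = v ⬝ᵥ v := fun {M} hM v => by
    rw [Matrix.dotProduct_mulVec, ← Matrix.mulVec_transpose, Matrix.mulVec_mulVec, hM,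
      Matrix.one_mulVec]
  obtain ⟨V, hV, hVG⟩ := exists_orthogonal_frobSq_le_trace (Wᵀ * B) fun v => by
    have h := frobSq_transpose_mul_le hW (Matrix.of fun i (_ : Fin 1) => (B *ᵥ v) i)
    rw [← hcontr hB v, ← Matrix.mulVec_mulVec]
    simpa [frobSq, Matrix.mul_apply, Matrix.mulVec, dotProduct, sq] using h
  have hVV : Vᵀ * V = 1 := (Matrix.mem_orthogonalGroup_iff' (Fin r) ℝ).1 hV
  have hle : subspaceDist B W ≤ frobNorm (B - W * V) :=
    ciInf_le (f := fun V : Matrix.orthogonalGroup (Fin r) ℝ =>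
      frobNorm (B - W * (V : Matrix (Fin r) (Fin r) ℝ)))
      ⟨0, by rintro _ ⟨V, rfl⟩; exact Real.sqrt_nonneg _⟩ ⟨V, hV⟩
  have h0 : 0 ≤ subspaceDist B W := Real.iInf_nonneg fun V => Real.sqrt_nonneg _
  calc subspaceDist B W ^ 2 ≤ frobNorm (B - W * V) ^ 2 := pow_le_pow_left₀ h0 hle 2
    _ = frobSq (B - W * V) := Real.sq_sqrt (frobSq_nonneg _)
    _ = 2 * (r - (Vᵀ * (Wᵀ * B)).trace) := by
        have hexp : (B - W * V)ᵀ * (B - W * V)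
            = 1 - Vᵀ * (Wᵀ * B) - (Vᵀ * (Wᵀ * B))ᵀ + 1 := by
          have h : Vᵀ * ((Wᵀ * W) * V) = 1 := by rw [hW, Matrix.one_mul, hVV]
          simp only [Matrix.transpose_sub, Matrix.transpose_mul, Matrix.transpose_transpose,
            Matrix.sub_mul, Matrix.mul_sub, Matrix.mul_assoc, hB] at h ⊢
          rw [h]
          abel
        rw [frobSq_eq_trace_transpose_mul, hexp]
        simp only [Matrix.trace_add, Matrix.trace_sub, Matrix.trace_transpose, Matrix.trace_one,
          Fintype.card_fin]
        ring
    _ ≤ 2 * (r - frobSq (Wᵀ * B)) := by linarith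

/-! ### Singular values and perturbation of singular subspaces -/

/-- If `n = dim F`, then the `n`-th singular value of `T : E → F` bounds the adjoint of `T` from
below. -/
theorem LinearMap.sq_singularValues_mul_le_norm_adjoint {E F : Type*}
    [NormedAddCommGroup E] [InnerProductSpace ℝ E] [FiniteDimensional ℝ E]
    [NormedAddCommGroup F] [InnerProductSpace ℝ F] [FiniteDimensional ℝ F]
    (T : E →ₗ[ℝ] F) {n : ℕ} (hn : Module.finrank ℝ F = n) (v : F) :
    T.singularValues (n - 1) ^ 2 * ‖v‖ ^ 2 ≤ ‖T.adjoint v‖ ^ 2 := by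
  rcases (T.singularValues_nonneg (n - 1)).eq_or_lt with h0 | hpos
  · rw [← h0]
    simp only [ne_eq, OfNat.ofNat_ne_zero, not_false_eq_true, zero_pow, zero_mul]
    positivity
  set N := Module.finrank ℝ E with hN
  have hnN : n - 1 < N := by
    by_contra h
    rw [T.singularValues_of_finrank_le (not_lt.1 h)] at hpos
    exact lt_irrefl _ hpos
  have hemb : ∀ i : Fin n, (i : ℕ) < N := fun i => by have := i.2; omega
  have hσ : ∀ i : Fin n, T.singularValues (n - 1) ≤ T.singularValues i := fun i =>
    T.singularValues_antitone (by have := i.2; omega)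
  set e := T.isSymmetric_adjoint_comp_self.eigenvectorBasis hN.symm with he
  have hTe : ∀ i j, inner ℝ (T (e i)) (T (e j)) =
      if i = j then T.singularValues i ^ 2 else 0 := fun i j => by
    rw [← LinearMap.adjoint_inner_left, ← LinearMap.comp_apply,
      T.isSymmetric_adjoint_comp_self.apply_eigenvectorBasis hN.symm i, inner_smul_left,
      orthonormal_iff_ite.1 e.orthonormal i j, T.sq_singularValues_fin hN.symm i]
    simp
  set u : Fin n → F := fun i => (T.singularValues i)⁻¹ • T (e ⟨i, hemb i⟩) with hu
  have hou : Orthonormal ℝ u := by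
    rw [orthonormal_iff_ite]
    intro i j
    have hi := hpos.trans_le (hσ i)
    simp only [hu, inner_smul_left, inner_smul_right, hTe, Fin.mk.injEq, Fin.val_inj]
    by_cases h : i = j
    · subst h
      simp only [if_true, conj_trivial]
      field_simp
    · simp [h]
  let b : OrthonormalBasis (Fin n) ℝ F := OrthonormalBasis.mk hou (by
    rw [hou.linearIndependent.span_eq_top_of_card_eq_finrank' (by simp [hn])])
  have hb : ∀ i, b i = u i := fun i => by simp [b]
  rw [← b.sum_sq_norm_inner_right, ← e.sum_sq_norm_inner_right, Finset.mul_sum]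
  have hinj : Function.Injective fun i : Fin n => (⟨i, hemb i⟩ : Fin N) := fun i j h => by
    simpa [Fin.ext_iff] using h
  calc ∑ i, T.singularValues (n - 1) ^ 2 * ‖inner ℝ (b i) v‖ ^ 2
      ≤ ∑ i : Fin n, ‖inner ℝ (e ⟨i, hemb i⟩) (T.adjoint v)‖ ^ 2 := by
        refine Finset.sum_le_sum fun i _ => ?_
        have hi := hpos.trans_le (hσ i)
        rw [LinearMap.adjoint_inner_right, hb, hu]
        simp only [inner_smul_left, conj_trivial, norm_mul, Real.norm_eq_abs, mul_pow, sq_abs]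
        rw [inv_pow, ← mul_assoc]
        refine mul_le_of_le_one_left (sq_nonneg _) ?_
        rw [← div_eq_mul_inv, div_le_one (by positivity)]
        exact pow_le_pow_left₀ hpos.le (hσ i) 2
    _ = ∑ k ∈ Finset.univ.map ⟨_, hinj⟩, ‖inner ℝ (e k) (T.adjoint v)‖ ^ 2 := by
        rw [Finset.sum_map]
        rfl
    _ ≤ ∑ k, ‖inner ℝ (e k) (T.adjoint v)‖ ^ 2 :=
        Finset.sum_le_sum_of_subset_of_nonneg (Finset.subset_univ _) fun _ _ _ => by positivity

theorem sq_matrixSingularValue_mul_frobSq_le {p q r : ℕ} (A : Matrix (Fin r) (Fin q) ℝ)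
    (C : Matrix (Fin p) (Fin r) ℝ) :
    matrixSingularValue A r ^ 2 * frobSq C ≤ frobSq (C * A) := by
  simp only [frobSq, Finset.mul_sum]
  refine Finset.sum_le_sum fun k _ => ?_
  have h := (Matrix.toEuclideanLin A).sq_singularValues_mul_le_norm_adjoint (n := r) (by simp)
    (WithLp.toLp 2 (C k))
  rw [← Matrix.toEuclideanLin_conjTranspose_eq_adjoint, EuclideanSpace.norm_sq_eq,
    EuclideanSpace.norm_sq_eq, Finset.mul_sum] at h
  simpa [matrixSingularValue, Matrix.mul_apply, Matrix.toLpLin_apply, Matrix.mulVec, dotProduct,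
    mul_comm] using h

/-- **Perturbation bound of Davis–Kahan–Wedin type**: top-`r` left singular vectors of `A` span
nearly the column space of a matrix `B * M` of rank `r` close to `A`. Only the singular value
`σ_r` of the target enters, no gap of `A`. -/
theorem IsTopLeftSingular.sq_mul_subspaceDist_sq_le {p q r : ℕ} {A : Matrix (Fin p) (Fin q) ℝ}
    {W B : Matrix (Fin p) (Fin r) ℝ} (h : IsTopLeftSingular A W) (hB : Bᵀ * B = 1)
    (M : Matrix (Fin r) (Fin q) ℝ) :
    matrixSingularValue M r ^ 2 * subspaceDist B W ^ 2 ≤ 8 * frobSq (A - B * M) := by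
  have hW := h.transpose_mul_self
  set D := A - B * M with hD
  -- The residual of `A` is no larger than the one with respect to the column space of `B`.
  have h1 : frobSq (A - W * (Wᵀ * A)) ≤ frobSq D := by
    have hres : A - B * (Bᵀ * A) = D - B * (Bᵀ * D) := by
      have : B * ((Bᵀ * B) * M) = B * M := by rw [hB, Matrix.one_mul]
      rw [Matrix.mul_assoc] at this
      rw [hD, Matrix.mul_sub, Matrix.mul_sub, this]
      abel
    calc frobSq (A - W * (Wᵀ * A)) = frobSq A - frobSq (Wᵀ * A) := frobSq_sub_proj hW A
      _ ≤ frobSq A - frobSq (Bᵀ * A) := by linarith [h.frobSq_le hB]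
      _ = frobSq (D - B * (Bᵀ * D)) := by rw [← frobSq_sub_proj hB, hres]
      _ ≤ frobSq D := by linarith [frobSq_sub_proj hB D, frobSq_nonneg (Bᵀ * D)]
  have h2 : frobSq (D - W * (Wᵀ * D)) ≤ frobSq D := by
    linarith [frobSq_sub_proj hW D, frobSq_nonneg (Wᵀ * D)]
  have h3 : (B - W * (Wᵀ * B)) * M = (A - W * (Wᵀ * A)) - (D - W * (Wᵀ * D)) := by
    rw [hD]
    simp only [Matrix.sub_mul, Matrix.mul_sub, Matrix.mul_assoc]
    abel
  have h4 := sq_matrixSingularValue_mul_frobSq_le M (B - W * (Wᵀ * B))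
  rw [h3] at h4
  have h5 := frobSq_sub_le (A - W * (Wᵀ * A)) (D - W * (Wᵀ * D))
  have h6 := subspaceDist_sq_le hB hW
  rw [← frobSq_of_transpose_mul_eq_one hB, ← frobSq_sub_proj hW] at h6
  nlinarith [sq_nonneg (matrixSingularValue M r)]

theorem IsTopLeftSingular.subspaceDist_sq_le_two_mul {p q r : ℕ} {A : Matrix (Fin p) (Fin q) ℝ}
    {W B : Matrix (Fin p) (Fin r) ℝ} (h : IsTopLeftSingular A W) (hB : Bᵀ * B = 1) :
    subspaceDist B W ^ 2 ≤ 2 * r := by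
  linarith [subspaceDist_sq_le hB h.transpose_mul_self, frobSq_nonneg (Wᵀ * B)]

/-- Two orthonormal bases of the whole space span the same space. -/
theorem subspaceDist_eq_zero_of_square {p : ℕ} {B W : Matrix (Fin p) (Fin p) ℝ}
    (hB : Bᵀ * B = 1) (hW : Wᵀ * W = 1) : subspaceDist B W = 0 := by
  have hW' : W * Wᵀ = 1 := mul_eq_one_comm.1 hW
  have h1 := subspaceDist_sq_le hB hW
  have h2 := frobSq_sub_proj hW B
  rw [← Matrix.mul_assoc, hW', Matrix.one_mul, sub_self, frobSq_of_transpose_mul_eq_one hB] at h2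
  have h3 : frobSq (0 : Matrix (Fin p) (Fin p) ℝ) = 0 := by simp [frobSq]
  have h4 : subspaceDist B W ^ 2 ≤ 0 := by linarith
  exact pow_eq_zero_iff two_ne_zero |>.1 (le_antisymm h4 (sq_nonneg _))

/-! ### Stein's identity for the score -/

theorem IsDiffDensity.measurable {p : ℕ} {P : (Fin p → ℝ) → ℝ} (hP : IsDiffDensity P) :
    Measurable P :=
  hP.differentiable.continuous.measurable

theorem IsDiffDensity.isProbabilityMeasure {p : ℕ} {P : (Fin p → ℝ) → ℝ}
    (hP : IsDiffDensity P) : IsProbabilityMeasure (densityLaw P) :=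
  ⟨by rw [densityLaw, withDensity_apply _ MeasurableSet.univ, setLIntegral_univ,
    hP.lintegral_eq_one]⟩

theorem measurable_partialDeriv {d : ℕ} (g : (Fin d → ℝ) → ℝ) (l : Fin d) :
    Measurable (partialDeriv g l) :=
  measurable_fderiv_apply_const ℝ g _

theorem IsDiffDensity.measurable_scoreFn {p : ℕ} {P : (Fin p → ℝ) → ℝ} (hP : IsDiffDensity P)
    (k : Fin p) : Measurable fun x => scoreFn P x k :=
  (measurable_partialDeriv P k).neg.div hP.measurable

theorem IsDiffDensity.integrable_densityLaw_iff {p : ℕ} {P : (Fin p → ℝ) → ℝ}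
    (hP : IsDiffDensity P) {g : (Fin p → ℝ) → ℝ} :
    Integrable g (densityLaw P) ↔ Integrable fun x => P x * g x := by
  rw [densityLaw, integrable_withDensity_iff_integrable_smul'
    hP.measurable.ennreal_ofReal (Filter.Eventually.of_forall fun _ => ENNReal.ofReal_lt_top)]
  simp only [ENNReal.toReal_ofReal (hP.nonneg _), smul_eq_mul]

theorem IsDiffDensity.integral_densityLaw {p : ℕ} {P : (Fin p → ℝ) → ℝ}
    (hP : IsDiffDensity P) (g : (Fin p → ℝ) → ℝ) :
    ∫ x, g x ∂(densityLaw P) = ∫ x, P x * g x := by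
  rw [densityLaw, integral_withDensity_eq_integral_toReal_smul
    hP.measurable.ennreal_ofReal (Filter.Eventually.of_forall fun _ => ENNReal.ofReal_lt_top)]
  simp only [ENNReal.toReal_ofReal (hP.nonneg _), smul_eq_mul]

/-- At a zero of the density its gradient vanishes too, since the zero is a minimum; so the junk
value of the score there does no harm. -/
theorem IsDiffDensity.mul_scoreFn {p : ℕ} {P : (Fin p → ℝ) → ℝ} (hP : IsDiffDensity P)
    (k : Fin p) (x : Fin p → ℝ) : P x * scoreFn P x k = -partialDeriv P k x := by
  by_cases h : P x = 0
  · have hmin : IsLocalMin P x := Filter.Eventually.of_forall fun y => h ▸ hP.nonneg y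
    simp [h, partialDeriv, hmin.fderiv_eq_zero]
  · simp only [scoreFn]
    field_simp

/-- **Stein's identity**: integration by parts against the density `P`. -/
theorem IsDiffDensity.integral_scoreFn_mul {p : ℕ} {P : (Fin p → ℝ) → ℝ} (hP : IsDiffDensity P)
    {g : (Fin p → ℝ) → ℝ} (hg : Differentiable ℝ g) (k : Fin p)
    (hsg : Integrable (fun x => scoreFn P x k * g x) (densityLaw P))
    (hdg : Integrable (partialDeriv g k) (densityLaw P)) (hg1 : Integrable g (densityLaw P)) :
    ∫ x, scoreFn P x k * g x ∂(densityLaw P) = ∫ x, partialDeriv g k x ∂(densityLaw P) := by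
  have hrw : ∀ x, P x * (scoreFn P x k * g x) = -(partialDeriv P k x * g x) := fun x => by
    rw [← mul_assoc, hP.mul_scoreFn, neg_mul]
  rw [hP.integrable_densityLaw_iff] at hsg hdg hg1
  simp only [hrw] at hsg
  rw [hP.integral_densityLaw, hP.integral_densityLaw]
  simp only [hrw]
  rw [integral_neg]
  exact (integral_mul_fderiv_eq_neg_fderiv_mul_of_integrable (by simpa [partialDeriv] using hsg.neg) hdg hg1
    (fun x _ => hP.differentiable x) (fun x _ => hg x)).symm

theorem differentiable_comp_mulVec {p r : ℕ} {f : (Fin r → ℝ) → ℝ} (hf : Differentiable ℝ f)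
    (A : Matrix (Fin r) (Fin p) ℝ) : Differentiable ℝ fun x => f (A *ᵥ x) :=
  hf.comp (LinearMap.toContinuousLinearMap A.mulVecLin).differentiable

theorem measurable_comp_mulVec {p r : ℕ} {f : (Fin r → ℝ) → ℝ} (hf : Differentiable ℝ f)
    (A : Matrix (Fin r) (Fin p) ℝ) : Measurable fun x => f (A *ᵥ x) :=
  (differentiable_comp_mulVec hf A).continuous.measurable

theorem partialDeriv_comp_transpose_mulVec {p r : ℕ} {f : (Fin r → ℝ) → ℝ}
    (hf : Differentiable ℝ f) (B : Matrix (Fin p) (Fin r) ℝ) (k : Fin p) (x : Fin p → ℝ) :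
    partialDeriv (fun x => f (Bᵀ *ᵥ x)) k x = ∑ l, B k l * partialDeriv f l (Bᵀ *ᵥ x) := by
  have h := (hf (Bᵀ *ᵥ x)).hasFDerivAt.comp x
    (LinearMap.toContinuousLinearMap Bᵀ.mulVecLin).hasFDerivAt
  have h' : HasFDerivAt (fun x => f (Bᵀ *ᵥ x)) _ x := h
  rw [partialDeriv, h'.fderiv]
  have hcol : Bᵀ *ᵥ Pi.single k 1 = ∑ l, B k l • (Pi.single l (1 : ℝ) : Fin r → ℝ) := by
    ext l
    simp [Pi.single_apply, Finset.sum_apply]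
  simp only [ContinuousLinearMap.comp_apply, LinearMap.coe_toContinuousLinearMap',
    Matrix.mulVecLin_apply, hcol, map_sum, map_smul, smul_eq_mul, partialDeriv]

/-- The population version of the cross moment matrix: `E[s(x) f_j(Bᵀ x)]` is the `j`-th column of
`B * M₁`. -/
theorem IsDiffDensity.integral_scoreFn_mul_link {p q r : ℕ} {P : (Fin p → ℝ) → ℝ}
    (hP : IsDiffDensity P) (B : Matrix (Fin p) (Fin r) ℝ) {f : Fin q → (Fin r → ℝ) → ℝ}
    (hf : ∀ j, Differentiable ℝ (f j))
    (hdf : ∀ j l, Integrable (fun x => partialDeriv (f j) l (Bᵀ *ᵥ x)) (densityLaw P))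
    (k : Fin p) (j : Fin q)
    (hsf : Integrable (fun x => scoreFn P x k * f j (Bᵀ *ᵥ x)) (densityLaw P))
    (hf1 : Integrable (fun x => f j (Bᵀ *ᵥ x)) (densityLaw P)) :
    ∫ x, scoreFn P x k * f j (Bᵀ *ᵥ x) ∂(densityLaw P) = (B * meanGradMatrix P B f) k j := by
  have hpd : partialDeriv (fun x => f j (Bᵀ *ᵥ x)) k =
      fun x => ∑ l, B k l * partialDeriv (f j) l (Bᵀ *ᵥ x) :=
    funext fun x => partialDeriv_comp_transpose_mulVec (hf j) B k x
  rw [hP.integral_scoreFn_mul (differentiable_comp_mulVec (hf j) Bᵀ) k hsf ?_ hf1, hpd,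
    integral_finsetSum _ fun l _ => (hdf j l).const_mul _]
  · simp only [integral_const_mul, Matrix.mul_apply, meanGradMatrix, Matrix.of_apply]
  · rw [hpd]
    exact integrable_finsetSum _ fun l _ => (hdf j l).const_mul _

/-! ### Bernstein's inequality from moment growth -/

/-- `Z` has sub-exponential moment growth with constant `K`: its `L^ℓ` norm is at most `K * ℓ` for
every positive integer `ℓ`. -/
def SubExponentialMoments {Ω : Type*} [MeasurableSpace Ω] (μ : Measure Ω) (Z : Ω → ℝ) (K : ℝ) :
    Prop :=
  ∀ ℓ : ℕ, 1 ≤ ℓ → eLpNorm Z (ℓ : ℝ≥0∞) μ ≤ ENNReal.ofReal (K * ℓ)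

section Moments

variable {Ω : Type*} [MeasurableSpace Ω] {μ : Measure Ω}

theorem SubExponentialMoments.integrable {Z : Ω → ℝ} {K : ℝ} (h : SubExponentialMoments μ Z K)
    (hZ : Measurable Z) : Integrable Z μ := by
  rw [← memLp_one_iff_integrable]
  exact ⟨hZ.aestronglyMeasurable, by simpa using (h 1 le_rfl).trans_lt ENNReal.ofReal_lt_top⟩

theorem SubExponentialMoments.neg {Z : Ω → ℝ} {K : ℝ} (h : SubExponentialMoments μ Z K) :
    SubExponentialMoments μ (-Z) K := fun ℓ hℓ => by
  rw [eLpNorm_neg]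
  exact h ℓ hℓ

/-- The moments of order `ℓ`, divided by `ℓ!`, grow geometrically. -/
theorem SubExponentialMoments.lintegral_le {Z : Ω → ℝ} {K : ℝ}
    (h : SubExponentialMoments μ Z K) (hK : 0 ≤ K) (t : ℝ) {ℓ : ℕ} (hℓ : 1 ≤ ℓ) :
    ∫⁻ ω, ENNReal.ofReal (|t * Z ω| ^ ℓ / ℓ.factorial) ∂μ ≤
      ENNReal.ofReal ((|t| * (Real.exp 1 * K)) ^ ℓ) := by
  have h1 : ∫⁻ ω, ‖Z ω‖ₑ ^ ℓ ∂μ ≤ ENNReal.ofReal ((K * ℓ) ^ ℓ) := by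
    have h2 := eLpNorm_nnreal_pow_eq_lintegral (μ := μ) (f := Z) (p := (ℓ : NNReal))
      (by simp; omega)
    simp only [NNReal.coe_natCast, ENNReal.rpow_natCast, ENNReal.coe_natCast] at h2
    rw [← h2, ENNReal.ofReal_pow (by positivity)]
    exact pow_le_pow_left' (h ℓ hℓ) ℓ
  have h3 : ∀ ω, ENNReal.ofReal (|t * Z ω| ^ ℓ / ℓ.factorial) =
      ENNReal.ofReal (|t| ^ ℓ / ℓ.factorial) * ‖Z ω‖ₑ ^ ℓ := fun ω => by
    rw [Real.enorm_eq_ofReal_abs, ← ENNReal.ofReal_pow (abs_nonneg _),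
      ← ENNReal.ofReal_mul (by positivity), abs_mul, mul_pow]
    congr 1
    ring
  simp only [h3]
  rw [lintegral_const_mul' _ _ ENNReal.ofReal_ne_top]
  calc _ ≤ ENNReal.ofReal (|t| ^ ℓ / ℓ.factorial) * ENNReal.ofReal ((K * ℓ) ^ ℓ) := by gcongr
    _ = ENNReal.ofReal ((|t| * K) ^ ℓ * ((ℓ : ℝ) ^ ℓ / ℓ.factorial)) := by
        rw [← ENNReal.ofReal_mul (by positivity)]
        congr 1
        rw [mul_pow, mul_pow]
        ring
    _ ≤ ENNReal.ofReal ((|t| * K) ^ ℓ * Real.exp ℓ) := by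
        gcongr
        exact Real.pow_div_factorial_le_exp _ (Nat.cast_nonneg _) ℓ
    _ = _ := by
        rw [← Real.exp_one_pow, ← mul_pow]
        congr 2
        ring

theorem hasSum_exp_abs_sub (u : ℝ) :
    HasSum (fun ℓ : ℕ => |u| ^ (ℓ + 2) / (ℓ + 2).factorial) (Real.exp |u| - 1 - |u|) := by
  have h := NormedSpace.expSeries_div_hasSum_exp (𝔸 := ℝ) |u|
  rw [← Real.exp_eq_exp_ℝ, ← hasSum_nat_add_iff' 2] at h
  simpa [Finset.sum_range_succ, sub_sub] using h

theorem Real.exp_le_one_add_add_remainder (u : ℝ) :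
    Real.exp u ≤ 1 + u + (Real.exp |u| - 1 - |u|) := by
  rcases le_total 0 u with h | h
  · rw [abs_of_nonneg h]
    linarith
  · rw [abs_of_nonpos h]
    have := Real.self_le_sinh_iff.2 (neg_nonneg.2 h)
    rw [Real.sinh_eq, neg_neg] at this
    linarith

/-- A variable with sub-exponential moments has, after centering, a Gaussian bound on its moment
generating function near `0`. -/
theorem SubExponentialMoments.mgf_sub_integral_le [IsProbabilityMeasure μ] {Z : Ω → ℝ} {K : ℝ}
    (h : SubExponentialMoments μ Z K) (hZ : Measurable Z) (hK : 0 ≤ K) {t : ℝ}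
    (ht : |t| * (Real.exp 1 * K) ≤ 1 / 2) :
    Integrable (fun ω => Real.exp (t * (Z ω - μ[Z]))) μ ∧
      mgf (fun ω => Z ω - μ[Z]) μ t ≤ Real.exp (2 * (Real.exp 1 * K) ^ 2 * t ^ 2) := by
  set x := |t| * (Real.exp 1 * K) with hx
  have hx0 : 0 ≤ x := by positivity
  set R : Ω → ℝ := fun ω => Real.exp |t * Z ω| - 1 - |t * Z ω| with hR
  have hR0 : ∀ ω, 0 ≤ R ω := fun ω => by
    have := Real.add_one_le_exp |t * Z ω|
    simp only [hR]
    linarith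
  have hRm : Measurable R := by fun_prop
  have hRint : ∫⁻ ω, ENNReal.ofReal (R ω) ∂μ ≤ ENNReal.ofReal (2 * x ^ 2) := by
    have h1 : ∀ ω, ENNReal.ofReal (R ω) =
        ∑' ℓ : ℕ, ENNReal.ofReal (|t * Z ω| ^ (ℓ + 2) / (ℓ + 2).factorial) := fun ω => by
      rw [← ENNReal.ofReal_tsum_of_nonneg (fun _ => by positivity)
        (hasSum_exp_abs_sub _).summable, (hasSum_exp_abs_sub _).tsum_eq]
    have hgeo := (hasSum_geometric_of_lt_one hx0 (by linarith)).mul_left (x ^ 2)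
    simp only [h1]
    rw [lintegral_tsum fun ℓ => by fun_prop]
    calc _ ≤ ∑' ℓ : ℕ, ENNReal.ofReal (x ^ 2 * x ^ ℓ) := by
          refine ENNReal.tsum_le_tsum fun ℓ => ?_
          rw [← pow_add, add_comm 2 ℓ]
          exact h.lintegral_le hK t (by omega)
      _ = ENNReal.ofReal (x ^ 2 * (1 - x)⁻¹) := by
          rw [← ENNReal.ofReal_tsum_of_nonneg (fun _ => by positivity) hgeo.summable, hgeo.tsum_eq]
      _ ≤ _ := by
          refine ENNReal.ofReal_le_ofReal ?_
          have : (1 - x)⁻¹ ≤ 2 := by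
            rw [inv_le_comm₀ (by linarith) (by norm_num)]
            linarith
          nlinarith [sq_nonneg x]
  have hRi : Integrable R μ := ⟨hRm.aestronglyMeasurable, by
    rw [hasFiniteIntegral_iff_ofReal (Filter.Eventually.of_forall hR0)]
    exact hRint.trans_lt ENNReal.ofReal_lt_top⟩
  have hRle : ∫ ω, R ω ∂μ ≤ 2 * x ^ 2 := by
    rw [integral_eq_lintegral_of_nonneg_ae (Filter.Eventually.of_forall hR0)
      hRm.aestronglyMeasurable]
    exact ENNReal.toReal_le_of_le_ofReal (by positivity) hRint
  have hZi := h.integrable hZ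
  have hlin : Integrable (fun ω => 1 + t * Z ω) μ := (integrable_const 1).add (hZi.const_mul t)
  have hdom : Integrable (fun ω => 1 + t * Z ω + R ω) μ := hlin.add hRi
  have hexp : Integrable (fun ω => Real.exp (t * Z ω)) μ := by
    refine hdom.mono' (by fun_prop) (Filter.Eventually.of_forall fun ω => ?_)
    rw [Real.norm_eq_abs, abs_of_pos (Real.exp_pos _)]
    exact Real.exp_le_one_add_add_remainder _
  have hrw : (fun ω => Real.exp (t * (Z ω - μ[Z]))) =
      fun ω => Real.exp (-(t * μ[Z])) * Real.exp (t * Z ω) := by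
    ext ω
    rw [← Real.exp_add]
    congr 1
    ring
  refine ⟨by rw [hrw]; exact hexp.const_mul _, ?_⟩
  have hmean : ∫ ω, Real.exp (t * Z ω) ∂μ ≤ 1 + t * μ[Z] + 2 * x ^ 2 := by
    calc _ ≤ ∫ ω, 1 + t * Z ω + R ω ∂μ :=
          integral_mono hexp hdom fun ω => Real.exp_le_one_add_add_remainder _
      _ = 1 + t * μ[Z] + ∫ ω, R ω ∂μ := by
          rw [integral_add hlin hRi,
            integral_add (integrable_const 1) (hZi.const_mul t), integral_const_mul]
          simp
      _ ≤ _ := by linarith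
  rw [mgf, hrw, integral_const_mul]
  calc _ ≤ Real.exp (-(t * μ[Z])) * Real.exp (t * μ[Z] + 2 * x ^ 2) := by
        gcongr
        refine hmean.trans ?_
        linarith [Real.add_one_le_exp (t * μ[Z] + 2 * x ^ 2)]
    _ = _ := by
        rw [← Real.exp_add, hx, mul_pow, sq_abs]
        congr 1
        ring

/-- One-sided **Bernstein inequality** in the Gaussian regime `2 * L ≤ n`. -/
theorem measureReal_le_sum_sub_integral_le [IsProbabilityMeasure μ] {n : ℕ} {Z : Fin n → Ω → ℝ}
    {K L : ℝ} (hZ : ∀ i, Measurable (Z i)) (hind : iIndepFun Z μ) (hK : 0 < K)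
    (h : ∀ i, SubExponentialMoments μ (Z i) K) (hL : 0 ≤ L) (hn : 0 < n) (hLn : 2 * L ≤ n) :
    μ.real {ω | n * (Real.exp 1 * K * √(8 * L / n)) ≤ ∑ i, (Z i ω - μ[Z i])} ≤
      Real.exp (-L) := by
  set a := Real.exp 1 * K with ha
  have ha0 : 0 < a := by positivity
  have hn0 : (0 : ℝ) < n := by exact_mod_cast hn
  set s := √(8 * L / n) with hs
  have hs0 : 0 ≤ s := Real.sqrt_nonneg _
  have hss : s ^ 2 = 8 * L / n := Real.sq_sqrt (by positivity)
  have hs2 : s ≤ 2 := by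
    rw [hs]
    refine Real.sqrt_le_iff.2 ⟨by norm_num, ?_⟩
    rw [div_le_iff₀ hn0]
    linarith
  -- The exponent `t` minimises `-t * n * a * s + 2 * n * a ^ 2 * t ^ 2`.
  set t := s / (4 * a) with ht
  have ht0 : 0 ≤ t := by positivity
  have hta : |t| * a ≤ 1 / 2 := by
    rw [abs_of_nonneg ht0, ht]
    field_simp
    linarith
  have hi := fun i => (h i).mgf_sub_integral_le (hZ i) hK.le hta
  have hindW : iIndepFun (fun i ω => Z i ω - μ[Z i]) μ :=
    hind.comp (fun i y => y - ∫ x, Z i x ∂μ) fun i => measurable_id.sub_const _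
  have hWm : ∀ i, Measurable fun ω => Z i ω - μ[Z i] := fun i => (hZ i).sub_const _
  have hint := hindW.integrable_exp_mul_sum (t := t) hWm (s := Finset.univ) fun i _ => (hi i).1
  have hch := measure_ge_le_exp_mul_mgf (μ := μ) (n * (a * s)) ht0 hint
  rw [hindW.mgf_sum hWm] at hch
  simp only [Finset.sum_apply] at hch
  refine hch.trans ?_
  calc _ ≤ Real.exp (-t * (n * (a * s))) * ∏ _i : Fin n, Real.exp (2 * a ^ 2 * t ^ 2) := by
        gcongr with i
        · intro i _
          exact mgf_nonneg
        · exact (hi i).2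
    _ = Real.exp (-L) := by
        rw [Finset.prod_const, Finset.card_univ, Fintype.card_fin, ← Real.exp_nat_mul,
          ← Real.exp_add]
        congr 1
        have h1 : t * a = s / 4 := by rw [ht]; field_simp
        have h2 : n * s ^ 2 = 8 * L := by rw [hss]; field_simp
        calc _ = -(n * s * (t * a)) + 2 * n * (t * a) ^ 2 := by ring
          _ = -(n * s ^ 2) / 8 := by rw [h1]; ring
          _ = -L := by rw [h2]; ring

/-- Two-sided Bernstein inequality for an average with common mean `m`. -/
theorem measureReal_lt_abs_average_sub_le [IsProbabilityMeasure μ] {n : ℕ} {Z : Fin n → Ω → ℝ}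
    {K L m : ℝ} (hZ : ∀ i, Measurable (Z i)) (hind : iIndepFun Z μ) (hK : 0 < K)
    (h : ∀ i, SubExponentialMoments μ (Z i) K) (hm : ∀ i, μ[Z i] = m) (hL : 0 ≤ L) (hn : 0 < n)
    (hLn : 2 * L ≤ n) :
    μ.real {ω | Real.exp 1 * K * √(8 * L / n) < |1 / (n : ℝ) * ∑ i, Z i ω - m|} ≤
      2 * Real.exp (-L) := by
  have hn0 : (0 : ℝ) < n := by exact_mod_cast hn
  have h1 := measureReal_le_sum_sub_integral_le hZ hind hK h hL hn hLn
  have h2 := measureReal_le_sum_sub_integral_le (fun i => (hZ i).neg)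
    (hind.comp (fun _ y => -y) fun _ => measurable_neg) hK (fun i => (h i).neg) hL hn hLn
  refine (measureReal_mono (fun ω hω => ?_)).trans ((measureReal_union_le _ _).trans
    ((add_le_add h1 h2).trans_eq (two_mul _).symm))
  set u := Real.exp 1 * K * √(8 * L / n)
  have hω' : u < |1 / (n : ℝ) * ∑ i, Z i ω - m| := hω
  rw [Set.mem_union, Set.mem_ofPred_eq, Set.mem_ofPred_eq]
  have e1 : ∑ i, (Z i ω - μ[Z i]) = n * (1 / (n : ℝ) * ∑ i, Z i ω - m) := by
    simp only [hm, Finset.sum_sub_distrib, Finset.sum_const, Finset.card_univ, Fintype.card_fin,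
      nsmul_eq_mul]
    field_simp
  have e2 : ∑ i, ((-Z i) ω - μ[-Z i]) = n * -(1 / (n : ℝ) * ∑ i, Z i ω - m) := by
    rw [mul_neg, ← e1, ← Finset.sum_neg_distrib]
    refine Finset.sum_congr rfl fun i _ => ?_
    have : μ[-Z i] = -μ[Z i] := integral_neg (Z i)
    rw [this, Pi.neg_apply]
    ring
  rw [e1, e2]
  rcases lt_abs.1 hω' with h' | h'
  · exact Or.inl (by gcongr)
  · exact Or.inr (by gcongr)

/-- A product of two sub-Gaussian variables is sub-exponential. -/
theorem SubGaussianMoments.mul {X Y : Ω → ℝ} {K₁ K₂ : ℝ} (hX : SubGaussianMoments μ X K₁)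
    (hY : SubGaussianMoments μ Y K₂) (hXm : Measurable X) (hYm : Measurable Y)
    (hK₁ : 0 ≤ K₁) : SubExponentialMoments μ (fun ω => X ω * Y ω) (2 * (K₁ * K₂)) := by
  intro ℓ hℓ
  have hℓ0 : (ℓ : ℝ≥0∞) ≠ 0 := by simp; omega
  have : ENNReal.HolderTriple ((2 * ℓ : ℕ) : ℝ≥0∞) ((2 * ℓ : ℕ) : ℝ≥0∞) (ℓ : ℝ≥0∞) := ⟨by
    push_cast
    rw [ENNReal.mul_inv (by simp) (by simp), ← two_mul, ← mul_assoc,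
      ENNReal.mul_inv_cancel (by simp) (by simp), one_mul]⟩
  have h := eLpNorm_smul_le_mul_eLpNorm (μ := μ) (p := ((2 * ℓ : ℕ) : ℝ≥0∞))
    (q := ((2 * ℓ : ℕ) : ℝ≥0∞)) (r := (ℓ : ℝ≥0∞)) hYm.aestronglyMeasurable
    hXm.aestronglyMeasurable
  refine h.trans ((mul_le_mul' (hX (2 * ℓ) (by omega)) (hY (2 * ℓ) (by omega))).trans_eq ?_)
  rw [← ENNReal.ofReal_mul (by positivity)]
  congr 1
  have : √((2 * ℓ : ℕ) : ℝ) * √((2 * ℓ : ℕ) : ℝ) = 2 * ℓ := by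
    rw [Real.mul_self_sqrt (by positivity)]
    push_cast
    ring
  linear_combination K₁ * K₂ * this

theorem SubGaussianMoments.add {X Y : Ω → ℝ} {K₁ K₂ : ℝ} (hX : SubGaussianMoments μ X K₁)
    (hY : SubGaussianMoments μ Y K₂) (hXm : Measurable X) (hYm : Measurable Y) (hK₁ : 0 ≤ K₁)
    (hK₂ : 0 ≤ K₂) : SubGaussianMoments μ (fun ω => X ω + Y ω) (K₁ + K₂) := by
  intro ℓ hℓ
  refine (eLpNorm_add_le hXm.aestronglyMeasurable hYm.aestronglyMeasurable
    (by exact_mod_cast hℓ)).trans ((add_le_add (hX ℓ hℓ) (hY ℓ hℓ)).trans_eq ?_)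
  rw [← ENNReal.ofReal_add (by positivity) (by positivity), add_mul]

/-- Uniformly bounded even moments are in particular sub-Gaussian; the odd ones follow from the
monotonicity of `L^ℓ` norms. -/
theorem SubGaussianMoments.of_even_moments [IsProbabilityMeasure μ] {X : Ω → ℝ} {K : ℝ}
    (hX : ∀ ℓ : ℕ, 1 ≤ ℓ → eLpNorm X ((2 * ℓ : ℕ) : ℝ≥0∞) μ ≤ ENNReal.ofReal K)
    (hXm : Measurable X) (hK : 0 ≤ K) : SubGaussianMoments μ X K := by
  intro ℓ hℓ
  calc _ ≤ eLpNorm X ((2 * ℓ : ℕ) : ℝ≥0∞) μ :=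
        eLpNorm_le_eLpNorm_of_exponent_le (by exact_mod_cast (by omega : ℓ ≤ 2 * ℓ))
          hXm.aestronglyMeasurable
    _ ≤ ENNReal.ofReal K := hX ℓ hℓ
    _ ≤ _ := by
        refine ENNReal.ofReal_le_ofReal (le_mul_of_one_le_right hK ?_)
        rw [Real.one_le_sqrt]
        exact_mod_cast hℓ

end Moments

/-! ### Concentration of the empirical cross moment matrix -/

theorem SubGaussianMoments.comp_of_map_eq {Ω E : Type*} [MeasurableSpace Ω] [MeasurableSpace E]
    {μ : Measure Ω} {ν : Measure E} {X : Ω → E} (hX : Measurable X) (hlaw : μ.map X = ν)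
    {g : E → ℝ} (hg : Measurable g) {K : ℝ} (h : SubGaussianMoments ν g K) :
    SubGaussianMoments μ (fun ω => g (X ω)) K := fun ℓ hℓ => by
  subst hlaw
  have := h ℓ hℓ
  rwa [eLpNorm_map_measure hg.aestronglyMeasurable hX.aemeasurable] at this

namespace IsIndexModelSample

variable {Ω : Type*} [MeasurableSpace Ω] {μ : Measure Ω} {n p q r : ℕ} {P : (Fin p → ℝ) → ℝ}
  {B : Matrix (Fin p) (Fin r) ℝ} {f : Fin q → (Fin r → ℝ) → ℝ} {X : Fin n → Ω → Fin p → ℝ}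
  {ε Y : Fin n → Ω → Fin q → ℝ}

theorem measurable_score_mul (h : IsIndexModelSample μ P B f X ε Y) (hP : IsDiffDensity P)
    (hf : ∀ j, Differentiable ℝ (f j)) (i : Fin n) (k : Fin p) (j : Fin q) :
    Measurable fun ω => scoreFn P (X i ω) k * Y i ω j := by
  simp only [h.model]
  exact ((hP.measurable_scoreFn k).comp (h.measurable_X i)).mul
    (((measurable_comp_mulVec (hf j) Bᵀ).comp (h.measurable_X i)).add
      ((measurable_pi_apply j).comp (h.measurable_noise i)))

theorem iIndepFun_score_mul (h : IsIndexModelSample μ P B f X ε Y) (hP : IsDiffDensity P)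
    (hf : ∀ j, Differentiable ℝ (f j)) (k : Fin p) (j : Fin q) :
    iIndepFun (fun i ω => scoreFn P (X i ω) k * Y i ω j) μ := by
  simp only [h.model]
  exact h.indep_sample.comp
    (fun _ z => scoreFn P z.1 k * (f j (Bᵀ *ᵥ z.1) + z.2 j)) fun _ =>
      ((hP.measurable_scoreFn k).comp measurable_fst).mul
        (((measurable_comp_mulVec (hf j) Bᵀ).comp measurable_fst).add
          ((measurable_pi_apply j).comp measurable_snd))

theorem subExponentialMoments_score_mul [IsProbabilityMeasure μ]
    (h : IsIndexModelSample μ P B f X ε Y) (hP : IsDiffDensity P)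
    (hf : ∀ j, Differentiable ℝ (f j)) {C₁ C₂ Cε : ℝ} (hC₁ : 0 ≤ C₁) (hC₂ : 0 ≤ C₂) (hCε : 0 ≤ Cε)
    (hs : ∀ k, SubGaussianMoments (densityLaw P) (fun x => scoreFn P x k) C₁)
    (hlink : ∀ j, SubGaussianMoments (densityLaw P) (fun x => f j (Bᵀ *ᵥ x)) C₂)
    (hε : ∀ i j, SubGaussianMoments μ (fun ω => ε i ω j) Cε) (i : Fin n) (k : Fin p) (j : Fin q) :
    SubExponentialMoments μ (fun ω => scoreFn P (X i ω) k * Y i ω j)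
      (2 * (C₁ * (C₂ + Cε))) := by
  simp only [h.model]
  have hX := h.measurable_X i
  have hεm : Measurable fun ω => ε i ω j := (measurable_pi_apply j).comp (h.measurable_noise i)
  have hsm := hP.measurable_scoreFn k
  have hfm : Measurable fun x => f j (Bᵀ *ᵥ x) := measurable_comp_mulVec (hf j) Bᵀ
  exact ((hs k).comp_of_map_eq hX (h.law_X i) hsm).mul
    (((hlink j).comp_of_map_eq hX (h.law_X i) hfm).add (hε i j) (hfm.comp hX) hεm hC₂ hCε)
    (hsm.comp hX) ((hfm.comp hX).add hεm) hC₁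

/-- The noise is centered and independent of the features, so it does not contribute to the
expected cross moment, which Stein's identity evaluates. -/
theorem integral_score_mul [IsProbabilityMeasure μ]
    (h : IsIndexModelSample μ P B f X ε Y) (hP : IsDiffDensity P)
    (hf : ∀ j, Differentiable ℝ (f j)) {C₁ C₂ : ℝ} (hC₁ : 0 ≤ C₁)
    (hdf : ∀ j l, Integrable (fun x => partialDeriv (f j) l (Bᵀ *ᵥ x)) (densityLaw P))
    (hs : ∀ k, SubGaussianMoments (densityLaw P) (fun x => scoreFn P x k) C₁)
    (hlink : ∀ j, SubGaussianMoments (densityLaw P) (fun x => f j (Bᵀ *ᵥ x)) C₂)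
    (i : Fin n) (k : Fin p) (j : Fin q) :
    ∫ ω, scoreFn P (X i ω) k * Y i ω j ∂μ = (B * meanGradMatrix P B f) k j := by
  have hX := h.measurable_X i
  have hεm : Measurable fun ω => ε i ω j := (measurable_pi_apply j).comp (h.measurable_noise i)
  have hsm := hP.measurable_scoreFn k
  have hfm : Measurable fun x => f j (Bᵀ *ᵥ x) := measurable_comp_mulVec (hf j) Bᵀ
  have hint : ∀ {g : (Fin p → ℝ) → ℝ} {K : ℝ}, Measurable g →
      SubGaussianMoments (densityLaw P) g K → Integrable g (densityLaw P) := fun hg hK =>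
    memLp_one_iff_integrable.1
      ⟨hg.aestronglyMeasurable, by simpa using (hK 1 le_rfl).trans_lt ENNReal.ofReal_lt_top⟩
  have hsf : Integrable (fun x => scoreFn P x k * f j (Bᵀ *ᵥ x)) (densityLaw P) :=
    ((hs k).mul (hlink j) hsm hfm hC₁).integrable (hsm.mul hfm)
  have hindep : IndepFun (fun ω => scoreFn P (X i ω) k) (fun ω => ε i ω j) μ :=
    (h.indep_noise i).comp hsm (measurable_pi_apply j)
  have hsX : Integrable (fun ω => scoreFn P (X i ω) k) μ := by
    have := hint hsm (hs k)
    rw [← h.law_X i] at this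
    exact this.comp_measurable hX
  have hsfX : Integrable (fun ω => scoreFn P (X i ω) k * f j (Bᵀ *ᵥ X i ω)) μ := by
    rw [← h.law_X i] at hsf
    exact hsf.comp_measurable hX
  have hsε : Integrable (fun ω => scoreFn P (X i ω) k * ε i ω j) μ :=
    hindep.integrable_mul hsX (h.integrable_noise i j)
  simp only [h.model, mul_add]
  rw [integral_add hsfX hsε,
    hindep.integral_fun_mul_eq_mul_integral hsX.aestronglyMeasurable hεm.aestronglyMeasurable,
    h.mean_noise, mul_zero, add_zero, ← hP.integral_scoreFn_mul_link B hf hdf k j hsf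
      (hint hfm (hlink j)), ← h.law_X i]
  exact (integral_map hX.aemeasurable (hsm.mul hfm).aestronglyMeasurable).symm

end IsIndexModelSample

theorem scoreCrossMoment_apply {n p q : ℕ} (P : (Fin p → ℝ) → ℝ) (x : Fin n → Fin p → ℝ)
    (y : Fin n → Fin q → ℝ) (k : Fin p) (j : Fin q) :
    scoreCrossMoment P x y k j = 1 / (n : ℝ) * ∑ i, scoreFn P (x i) k * y i j := by
  simp [scoreCrossMoment, Matrix.sum_apply, Matrix.vecMulVec_apply]

theorem frobSq_le_of_forall_abs_le {m n : ℕ} {A : Matrix (Fin m) (Fin n) ℝ} {u : ℝ}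
    (h : ∀ i j, |A i j| ≤ u) : frobSq A ≤ m * n * u ^ 2 := by
  calc frobSq A ≤ ∑ _i : Fin m, ∑ _j : Fin n, u ^ 2 := by
        refine Finset.sum_le_sum fun i _ => Finset.sum_le_sum fun j _ => ?_
        exact sq_le_sq' (by linarith [neg_abs_le (A i j), h i j]) ((le_abs_self _).trans (h i j))
    _ = _ := by simp [mul_assoc]

/-- Union bound over the entries of the empirical cross moment matrix. -/
theorem exists_event_scoreCrossMoment_close {Ω : Type*} [MeasurableSpace Ω] {μ : Measure Ω}
    [IsProbabilityMeasure μ] {n p q r : ℕ} {P : (Fin p → ℝ) → ℝ}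
    {B : Matrix (Fin p) (Fin r) ℝ} {f : Fin q → (Fin r → ℝ) → ℝ} {X : Fin n → Ω → Fin p → ℝ}
    {ε Y : Fin n → Ω → Fin q → ℝ} (h : IsIndexModelSample μ P B f X ε Y) (hP : IsDiffDensity P)
    (hf : ∀ j, Differentiable ℝ (f j)) {C₁ C₂ Cε : ℝ} (hC₁ : 0 < C₁) (hC₂ : 0 < C₂) (hCε : 0 < Cε)
    (hdf : ∀ j l, Integrable (fun x => partialDeriv (f j) l (Bᵀ *ᵥ x)) (densityLaw P))
    (hs : ∀ k, SubGaussianMoments (densityLaw P) (fun x => scoreFn P x k) C₁)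
    (hlink : ∀ j, SubGaussianMoments (densityLaw P) (fun x => f j (Bᵀ *ᵥ x)) C₂)
    (hε : ∀ i j, SubGaussianMoments μ (fun ω => ε i ω j) Cε)
    (hn : 0 < n) (hp : 0 < p) (hq : 0 < q) {δ : ℝ} (hδ : 0 < δ) (hδ1 : δ < 1)
    (hlog : 2 * Real.log (2 * (p * q / δ)) ≤ n) :
    ∃ E : Set Ω, MeasurableSet E ∧ ENNReal.ofReal (1 - δ) ≤ μ E ∧ ∀ ω ∈ E,
      frobSq (scoreCrossMoment P (fun i => X i ω) (fun i => Y i ω) - B * meanGradMatrix P B f) ≤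
        p * q * ((Real.exp 1 * (2 * (C₁ * (C₂ + Cε)))) ^ 2 *
          (8 * Real.log (2 * (p * q / δ)) / n)) := by
  have hp1 : (1 : ℝ) ≤ p := by exact_mod_cast hp
  have hq1 : (1 : ℝ) ≤ q := by exact_mod_cast hq
  have hpq1 : (1 : ℝ) ≤ p * q := one_le_mul_of_one_le_of_one_le hp1 hq1
  have hpq : 1 ≤ (p * q : ℝ) / δ := by
    rw [le_div_iff₀ hδ]
    linarith
  set L := Real.log (2 * (p * q / δ)) with hL
  have hL0 : 0 ≤ L := Real.log_nonneg (by linarith)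
  set K := 2 * (C₁ * (C₂ + Cε)) with hK
  have hK0 : 0 < K := by positivity
  set u := Real.exp 1 * K * √(8 * L / n) with hu
  set D : Fin p → Fin q → Ω → ℝ := fun k j ω =>
    1 / (n : ℝ) * ∑ i, scoreFn P (X i ω) k * Y i ω j - (B * meanGradMatrix P B f) k j with hD
  have hDm : ∀ k j, Measurable (D k j) := fun k j =>
    ((Finset.measurable_sum _ fun i _ => h.measurable_score_mul hP hf i k j).const_mul _).sub_const _
  have hbad : ∀ k j, μ.real {ω | u < |D k j ω|} ≤ 2 * Real.exp (-L) := fun k j =>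
    measureReal_lt_abs_average_sub_le (fun i => h.measurable_score_mul hP hf i k j)
      (h.iIndepFun_score_mul hP hf k j) hK0
      (fun i => h.subExponentialMoments_score_mul hP hf hC₁.le hC₂.le hCε.le hs hlink hε i k j)
      (fun i => h.integral_score_mul hP hf hC₁.le hdf hs hlink i k j) hL0 hn hlog
  have hEm : MeasurableSet (⋃ k, ⋃ j, {ω | u < |D k j ω|}) :=
    MeasurableSet.iUnion fun k => MeasurableSet.iUnion fun j =>
      measurableSet_lt measurable_const (hDm k j).abs
  have hEbad : μ.real (⋃ k, ⋃ j, {ω | u < |D k j ω|}) ≤ δ := by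
    calc _ ≤ ∑ k, ∑ j, μ.real {ω | u < |D k j ω|} :=
          (measureReal_iUnion_fintype_le _).trans
            (Finset.sum_le_sum fun k _ => measureReal_iUnion_fintype_le _)
      _ ≤ ∑ _k : Fin p, ∑ _j : Fin q, 2 * Real.exp (-L) :=
          Finset.sum_le_sum fun k _ => Finset.sum_le_sum fun j _ => hbad k j
      _ = δ := by
          rw [Real.exp_neg, hL, Real.exp_log (by linarith)]
          simp only [Finset.sum_const, Finset.card_univ, Fintype.card_fin, nsmul_eq_mul]
          have : (p : ℝ) ≠ 0 := by linarith
          have : (q : ℝ) ≠ 0 := by linarith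
          field_simp
  refine ⟨_, hEm.compl, ?_, fun ω hω => ?_⟩
  · rw [ENNReal.ofReal_le_iff_le_toReal (measure_ne_top _ _)]
    change 1 - δ ≤ μ.real _
    rw [probReal_compl_eq_one_sub hEm]
    linarith
  · have hω' : ∀ k j, |D k j ω| ≤ u := by
      simpa using hω
    have hsq : u ^ 2 = (Real.exp 1 * K) ^ 2 * (8 * L / n) := by
      rw [hu, mul_pow, Real.sq_sqrt (by positivity)]
    rw [← hsq]
    refine frobSq_le_of_forall_abs_le fun k j => ?_
    rw [Matrix.sub_apply, scoreCrossMoment_apply]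
    exact hω' k j

/-! ### The estimation error -/

theorem theorem2 (C₁ C₂ C₃ C₄ Cε : ℝ) (hC₁ : 0 < C₁) (hC₂ : 0 < C₂) (hC₃ : 0 < C₃) (hC₄ : 0 < C₄)
    (hCε : 0 < Cε) :
    ∃ C : ℝ, 0 < C ∧
      ∀ (n p q r : ℕ), 1 ≤ n → 1 ≤ q → 1 ≤ r →
      ∀ (P : (Fin p → ℝ) → ℝ), IsDiffDensity P →
      ∀ (B : Matrix (Fin p) (Fin r) ℝ), Bᵀ * B = 1 →
      ∀ (f : Fin q → (Fin r → ℝ) → ℝ), (∀ j, Differentiable ℝ (f j)) →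
      -- the expectations defining `M₁` exist
      (∀ j l, Integrable (fun x => partialDeriv (f j) l (Bᵀ *ᵥ x)) (densityLaw P)) →
      -- the entries of the score are sub-Gaussian
      (∀ k, SubGaussianMoments (densityLaw P) (fun x => scoreFn P x k) C₁) →
      -- the moments of the links are bounded
      (∀ j, ∀ ℓ : ℕ, 1 ≤ ℓ →
        eLpNorm (fun x => f j (Bᵀ *ᵥ x)) ((2 * ℓ : ℕ) : ℝ≥0∞) (densityLaw P) ≤
          ENNReal.ofReal C₂) →
      -- the mean partial derivatives of the links are `Ω(1/√r)`
      (∀ l j, C₃ * (1 / √(r : ℝ)) ≤ |meanGradMatrix P B f l j|) →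
      -- lower bound on the `r`-th singular value of `M₁`
      C₄ * √((q : ℝ) / r) ≤ matrixSingularValue (meanGradMatrix P B f) r →
      ∀ (Ω : Type*) [MeasurableSpace Ω] (μ : Measure Ω) [IsProbabilityMeasure μ]
        (X : Fin n → Ω → Fin p → ℝ) (ε Y : Fin n → Ω → Fin q → ℝ),
      IsIndexModelSample μ P B f X ε Y →
      -- the noise components are sub-Gaussian
      (∀ i j, SubGaussianMoments μ (fun ω => ε i ω j) Cε) →
      ∀ δ : ℝ, 0 < δ → δ < 1 →
        -- an event of probability at least `1 - δ` on which the bound holds, whichever top-`r`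
        -- left singular vectors are chosen as the estimator
        ∃ E : Set Ω, MeasurableSet E ∧ ENNReal.ofReal (1 - δ) ≤ μ E ∧
          ∀ ω ∈ E, ∀ Bhat : Matrix (Fin p) (Fin r) ℝ,
            IsTopLeftSingular (scoreCrossMoment P (fun i => X i ω) (fun i => Y i ω)) Bhat →
              subspaceDist B Bhat ≤
                C * (√((r : ℝ) * p / n) * √(Real.log ((p : ℝ) * q / δ))) := by
  set a := Real.exp 1 * (2 * (C₁ * (C₂ + Cε))) with ha
  have ha0 : 0 < a := by positivity
  refine ⟨12 * (a / C₄) + 3, by positivity, ?_⟩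
  intro n p q r hn hq hr P hP B hB f hf hdf hs hf2 _ hM Ω _ μ _ X ε Y h hε δ hδ hδ1
  have := hP.isProbabilityMeasure
  have hlink : ∀ j, SubGaussianMoments (densityLaw P) (fun x => f j (Bᵀ *ᵥ x)) C₂ := fun j =>
    SubGaussianMoments.of_even_moments (hf2 j)
      (measurable_comp_mulVec (hf j) Bᵀ) hC₂.le
  have hn0 : (0 : ℝ) < n := by exact_mod_cast hn
  have hr0 : (0 : ℝ) < r := by exact_mod_cast hr
  have hq1 : (1 : ℝ) ≤ q := by exact_mod_cast hq
  rcases Nat.lt_or_ge p 2 with hp | hp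
  · -- For `p = 1` the logarithm may be arbitrarily small, but then `r = p` and the distance is `0`.
    refine ⟨Set.univ, MeasurableSet.univ, ?_, fun ω _ Bhat hBhat => ?_⟩
    · rw [measure_univ]
      exact ENNReal.ofReal_le_one.2 (by linarith)
    · obtain ⟨U, σ, V, hrp, -⟩ := id hBhat
      obtain rfl : p = r := by omega
      rw [subspaceDist_eq_zero_of_square hB hBhat.transpose_mul_self]
      positivity
  have hp2 : (2 : ℝ) ≤ p := by exact_mod_cast hp
  set Λ := Real.log (p * q / δ) with hΛ
  have hpq : 2 ≤ (p * q : ℝ) / δ := by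
    rw [le_div_iff₀ hδ]
    nlinarith
  have hΛ0 : 0 ≤ Λ := Real.log_nonneg (by linarith)
  have hLΛ : Real.log (2 * (p * q / δ)) ≤ 2 * Λ := by
    rw [Real.log_mul (by norm_num) (by linarith), two_mul]
    exact add_le_add_left (Real.log_le_log (by norm_num) hpq) Λ
  -- It suffices to compare squares.
  have hfinish : ∀ d c : ℝ, 0 ≤ c → c ≤ 12 * (a / C₄) + 3 →
      d ^ 2 ≤ c ^ 2 * (r * p / n * Λ) →
      d ≤ (12 * (a / C₄) + 3) * (√((r : ℝ) * p / n) * √Λ) := fun d c hc hcC hd => by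
    rw [← Real.sqrt_mul (by positivity)]
    calc d ≤ √(c ^ 2 * (r * p / n * Λ)) := Real.le_sqrt_of_sq_le hd
      _ = c * √(r * p / n * Λ) := by rw [Real.sqrt_mul (sq_nonneg c), Real.sqrt_sq hc]
      _ ≤ _ := by gcongr
  by_cases hlog : 2 * Real.log (2 * (p * q / δ)) ≤ n
  · obtain ⟨E, hEm, hE, hEω⟩ := exists_event_scoreCrossMoment_close h hP hf hC₁ hC₂ hCε hdf hs
      hlink hε hn (by omega) hq hδ hδ1 hlog
    refine ⟨E, hEm, hE, fun ω hω Bhat hBhat => ?_⟩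
    refine hfinish _ (12 * (a / C₄)) (by positivity) (by linarith) ?_
    have h1 := hBhat.sq_mul_subspaceDist_sq_le hB (meanGradMatrix P B f)
    have h2 := hEω ω hω
    have h3 : C₄ ^ 2 * (q / r) ≤ matrixSingularValue (meanGradMatrix P B f) r ^ 2 := by
      calc _ = (C₄ * √((q : ℝ) / r)) ^ 2 := by rw [mul_pow, Real.sq_sqrt (by positivity)]
        _ ≤ _ := pow_le_pow_left₀ (by positivity) hM 2
    set d := subspaceDist B Bhat
    have hq0 : (0 : ℝ) < q := by linarith
    have h4 : C₄ ^ 2 * (q / r) * d ^ 2 ≤ 8 * (p * q * (a ^ 2 * (8 * (2 * Λ) / n))) := by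
      calc _ ≤ _ := mul_le_mul_of_nonneg_right h3 (sq_nonneg d)
        _ ≤ _ := h1
        _ ≤ _ := mul_le_mul_of_nonneg_left h2 (by norm_num)
        _ ≤ _ := by gcongr
    have h5 : d ^ 2 ≤ 128 * (a / C₄) ^ 2 * (r * p / n * Λ) := by
      refine le_of_mul_le_mul_left (h4.trans_eq ?_) (show 0 < C₄ ^ 2 * ((q : ℝ) / r) by positivity)
      field_simp
      ring
    refine h5.trans (mul_le_mul_of_nonneg_right ?_ (by positivity))
    nlinarith [sq_nonneg (a / C₄)]
  · -- With `n` this small the claimed bound exceeds the trivial one.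
    refine ⟨Set.univ, MeasurableSet.univ, ?_, fun ω _ Bhat hBhat => ?_⟩
    · rw [measure_univ]
      exact ENNReal.ofReal_le_one.2 (by linarith)
    · refine hfinish _ 3 (by norm_num) (by linarith [div_pos ha0 hC₄]) ?_
      have h1 : 1 ≤ 4 * (Λ / n) := by
        rw [← mul_div_assoc, le_div_iff₀ hn0]
        linarith
      calc _ ≤ 2 * (r : ℝ) := hBhat.subspaceDist_sq_le_two_mul hB
        _ ≤ 1 * (r * p) := by nlinarith
        _ ≤ 4 * (Λ / n) * (r * p) := by gcongr
        _ = 4 * (r * p / n * Λ) := by ring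
        _ ≤ _ := by
            gcongr
            norm_num
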